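/- Let $\mathbb{F}$ be $\mathbb{R}$ or $\mathbb{C}$, and let $\mathbb{F}\langle x,x^*\rangle$ be the free $*$-algebra on $x=(x_1,\dots,x_g)$: the algebra of polynomials in the $2g$ noncommuting letters $x_1,\dots,x_g,x_1^*,\dots,x_g^*$ with coefficients in $\mathbb{F}$, with the conjugate-linear involution that interchanges $x_j$ and $x_j^*$ and reverses products. A polynomial is *analytic* if it is a polynomial in the variables $x_1,\dots,x_g$ only. A *$*$-ideal* is a left ideal $I$ with $I^*=I$ (it is then two-sided); the $*$-ideal generated by a set $P$ is the smallest $*$-ideal containing $P$. **Proposition 4.3.** Let $I\subseteq\mathbb{F}\langle x,x^*\rangle$ be a $*$-ideal generated by a (possibly infinite) set of analytic polynomials. Then there exists an $\mathbb{F}$-linear functional $L:\mathbb{F}\langle x,x^*\rangle\to\mathbb{F}$ which is hermitian ($L(a^*)=\overline{L(a)}$ for all $a$) and positive ($L(a^*a)\ge 0$ for all $a$), such that $$I=\{a\in\mathbb{F}\langle x,x^*\rangle : L(a^*a)=0\}.$$ Hence the $*$-algebra $\mathbb{F}\langle x,x^*\rangle/I$ is $O^*$-representable, i.e. it has a faithful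 $*$-representation: there is an injective unital $*$-homomorphism from $\mathbb{F}\langle x,x^*\rangle/I$ into the $*$-algebra of all adjointable linear operators on some pre-Hilbert space over $\mathbb{F}$. -/

import Mathlib

/-! ## Star-algebras: star-ideals, quotients, representations -/

section StarIdeals

variable {A : Type*} [Ring A] [StarRing A]

/-- A star-ideal of a star-ring `A`: a left ideal `I` (`Ideal A` means left ideal) with `I* = I`.
Since the star is an involution, `I* ⊆ I` is equivalent to `I* = I`. -/
class Ideal.IsStarIdeal (I : Ideal A) : Prop where
  star_mem' : ∀ a ∈ I, star a ∈ I

theorem Ideal.star_mem_of_isStarIdeal {I : Ideal A} [h : I.IsStarIdeal] {a : A} (ha : a ∈ I) :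
    star a ∈ I :=
  h.star_mem' a ha

/-- A star-ideal is automatically two-sided. -/
instance Ideal.IsStarIdeal.isTwoSided (I : Ideal A) [I.IsStarIdeal] : I.IsTwoSided where
  mul_mem_of_left {a} b ha := by
    have h := Ideal.star_mem_of_isStarIdeal (I.mul_mem_left (star b)
      (Ideal.star_mem_of_isStarIdeal ha))
    rwa [star_mul, star_star, star_star] at h

/-- The star-ideal generated by a set `P`: the intersection of all star-ideals containing `P`. -/
def starIdealSpan (P : Set A) : Ideal A :=
  sInf {J : Ideal A | J.IsStarIdeal ∧ P ⊆ (J : Set A)}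

instance starIdealSpan.isStarIdeal (P : Set A) : (starIdealSpan P).IsStarIdeal where
  star_mem' a ha := by
    simp only [starIdealSpan, Submodule.mem_sInf] at ha ⊢
    intro J hJ
    exact hJ.1.star_mem' a (ha J hJ)

theorem subset_starIdealSpan (P : Set A) : P ⊆ (starIdealSpan P : Set A) := by
  intro p hp
  simp only [starIdealSpan, SetLike.mem_coe, Submodule.mem_sInf]
  exact fun J hJ => hJ.2 hp

theorem starIdealSpan_le {P : Set A} {J : Ideal A} (hJ : J.IsStarIdeal) (h : P ⊆ (J : Set A)) :
    starIdealSpan P ≤ J :=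
  sInf_le ⟨hJ, h⟩

/-- The involution `[a]* = [a*]` on the quotient of a star-ring by a star-ideal. -/
instance Ideal.Quotient.instStarRingOfIsStarIdeal (I : Ideal A) [I.IsStarIdeal] :
    StarRing (A ⧸ I) where
  star := Quotient.map' star (by
    intro a b h
    rw [Submodule.quotientRel_def] at h ⊢
    rw [← star_sub]
    exact Ideal.star_mem_of_isStarIdeal h)
  star_involutive a := by
    obtain ⟨a, rfl⟩ := Ideal.Quotient.mk_surjective a
    exact congrArg (Ideal.Quotient.mk I) (star_star a)
  star_mul a b := by
    obtain ⟨a, rfl⟩ := Ideal.Quotient.mk_surjective a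
    obtain ⟨b, rfl⟩ := Ideal.Quotient.mk_surjective b
    exact congrArg (Ideal.Quotient.mk I) (star_mul a b)
  star_add a b := by
    obtain ⟨a, rfl⟩ := Ideal.Quotient.mk_surjective a
    obtain ⟨b, rfl⟩ := Ideal.Quotient.mk_surjective b
    exact congrArg (Ideal.Quotient.mk I) (star_add a b)

theorem Ideal.Quotient.star_mk (I : Ideal A) [I.IsStarIdeal] (a : A) :
    star (Ideal.Quotient.mk I a) = Ideal.Quotient.mk I (star a) :=
  rfl

instance Ideal.Quotient.instStarModuleOfIsStarIdeal {𝕜 : Type*} [CommRing 𝕜] [StarRing 𝕜]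
    [Algebra 𝕜 A] [StarModule 𝕜 A] (I : Ideal A) [I.IsStarIdeal] : StarModule 𝕜 (A ⧸ I) where
  star_smul c a := by
    obtain ⟨a, rfl⟩ := Ideal.Quotient.mk_surjective a
    exact congrArg (Ideal.Quotient.mk I) (star_smul c a)

end StarIdeals

section Functionals

variable {𝕜 A : Type*} [RCLike 𝕜] [Ring A] [StarRing A] [Algebra 𝕜 A]

/-- A linear functional is hermitian if `L(a*)` is the complex conjugate of `L(a)`. -/
def LinearMap.IsHermitianFunctional (L : A →ₗ[𝕜] 𝕜) : Prop :=
  ∀ a : A, L (star a) = star (L a)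

open scoped ComplexOrder in
/-- A linear functional is positive if `L(a* a)` is real and nonnegative for all `a`. -/
def LinearMap.IsPositiveFunctional (L : A →ₗ[𝕜] 𝕜) : Prop :=
  ∀ a : A, 0 ≤ L (star a * a)

end Functionals

section Adjointable

variable (𝕜 V : Type*) [RCLike 𝕜] [NormedAddCommGroup V] [InnerProductSpace 𝕜 V]

/-- The algebra of all adjointable operators on a pre-Hilbert space `V` (`V` need not be complete):
the linear maps `T : V → V`, bounded or not, for which there is a linear map `S : V → V` with
`⟪T v, w⟫ = ⟪v, S w⟫` for all `v, w`. -/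
def adjointableOperators : Subalgebra 𝕜 (Module.End 𝕜 V) where
  carrier := {T | ∃ S : Module.End 𝕜 V, ∀ v w : V, inner 𝕜 (T v) w = inner 𝕜 v (S w)}
  mul_mem' := by
    rintro T T' ⟨S, hS⟩ ⟨S', hS'⟩
    exact ⟨S' * S, fun v w => by simp [hS, hS']⟩
  add_mem' := by
    rintro T T' ⟨S, hS⟩ ⟨S', hS'⟩
    exact ⟨S + S', fun v w => by simp [inner_add_left, inner_add_right, hS, hS']⟩
  algebraMap_mem' c :=
    ⟨star c • 1, fun v w => by simp [Algebra.algebraMap_eq_smul_one, inner_smul_left,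
      inner_smul_right]⟩

variable {𝕜 V}

/-- An operator on `V` is determined by its inner products. -/
theorem adjointableOperators.ext_inner {S T : adjointableOperators 𝕜 V}
    (h : ∀ v w : V, inner 𝕜 v (S.1 w) = inner 𝕜 v (T.1 w)) : S = T :=
  Subtype.ext (LinearMap.ext fun w => ext_inner_left 𝕜 fun v => h v w)

theorem adjointableOperators.exists_adjoint (T : adjointableOperators 𝕜 V) :
    ∃ S : adjointableOperators 𝕜 V, ∀ v w : V, inner 𝕜 (T.1 v) w = inner 𝕜 v (S.1 w) := by
  obtain ⟨S, hS⟩ := T.2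
  refine ⟨⟨S, T.1, fun v w => ?_⟩, hS⟩
  rw [← inner_conj_symm, ← hS, inner_conj_symm]

noncomputable instance adjointableOperators.instStar : Star (adjointableOperators 𝕜 V) where
  star T := Classical.choose (adjointableOperators.exists_adjoint T)

theorem adjointableOperators.inner_star_right (T : adjointableOperators 𝕜 V) (v w : V) :
    inner 𝕜 v ((star T).1 w) = inner 𝕜 (T.1 v) w :=
  (Classical.choose_spec (adjointableOperators.exists_adjoint T) v w).symm

theorem adjointableOperators.inner_star_left (T : adjointableOperators 𝕜 V) (v w : V) :
    inner 𝕜 ((star T).1 v) w = inner 𝕜 v (T.1 w) := by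
  rw [← inner_conj_symm, adjointableOperators.inner_star_right, inner_conj_symm]

/-- The involution on the adjointable operators is the adjoint. -/
noncomputable instance adjointableOperators.instStarRing :
    StarRing (adjointableOperators 𝕜 V) where
  star_involutive T := adjointableOperators.ext_inner fun v w => by
    rw [adjointableOperators.inner_star_right, adjointableOperators.inner_star_left]
  star_mul S T := adjointableOperators.ext_inner fun v w => by
    rw [adjointableOperators.inner_star_right]
    simp only [MulMemClass.coe_mul, Module.End.mul_apply]
    rw [adjointableOperators.inner_star_right, adjointableOperators.inner_star_right]
  star_add S T := adjointableOperators.ext_inner fun v w => by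
    rw [adjointableOperators.inner_star_right]
    simp only [AddMemClass.coe_add, LinearMap.add_apply, inner_add_left, inner_add_right]
    rw [adjointableOperators.inner_star_right, adjointableOperators.inner_star_right]

instance adjointableOperators.instStarModule : StarModule 𝕜 (adjointableOperators 𝕜 V) where
  star_smul c T := adjointableOperators.ext_inner fun v w => by
    rw [adjointableOperators.inner_star_right]
    change inner 𝕜 (c • T.1 v) w = inner 𝕜 v (star c • (star T).1 w)
    rw [inner_smul_left, inner_smul_right, adjointableOperators.inner_star_right]
    rfl

end Adjointable

universe u

/-- A star-algebra `A` over `𝕜` is O*-representable if it has a faithful star-representation: an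
injective unital star-homomorphism into the star-algebra of all adjointable operators on some
pre-Hilbert space `V` over `𝕜`. (Nothing is lost by taking `V` in the universe of `A`: a faithful
representation on any space restricts to a faithful one on an invariant subspace
spanned by `|A|` many vectors.) -/
def IsOStarRepresentable (𝕜 : Type*) (A : Type u) [RCLike 𝕜] [Ring A] [StarRing A]
    [Algebra 𝕜 A] [StarModule 𝕜 A] : Prop :=
  ∃ (V : Type u) (_ : NormedAddCommGroup V) (_ : InnerProductSpace 𝕜 V)
    (π : A →⋆ₐ[𝕜] adjointableOperators 𝕜 V), Function.Injective π

/-! ## The free star-algebra -/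

/-- The `2g` letters `x_1, …, x_g, x_1*, …, x_g*`. -/
inductive StarLetter (g : ℕ) : Type
  | x (j : Fin g) : StarLetter g
  | xStar (j : Fin g) : StarLetter g

namespace StarLetter

/-- The swap `x_j ↔ x_j*` of the letters. -/
def adjoint {g : ℕ} : StarLetter g → StarLetter g
  | x j => xStar j
  | xStar j => x j

theorem adjoint_adjoint {g : ℕ} (l : StarLetter g) : l.adjoint.adjoint = l := by
  cases l <;> rfl

end StarLetter

/-- The monoid of words in the letters `x_j, x_j*`; the unit is the empty word. -/
abbrev StarWord (g : ℕ) : Type := FreeMonoid (StarLetter g)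

namespace StarWord

variable {g : ℕ}

/-- The adjoint of a word: reverse it and replace each letter by its adjoint. -/
def adjoint (w : StarWord g) : StarWord g :=
  FreeMonoid.ofList ((w.toList.map StarLetter.adjoint).reverse)

theorem adjoint_adjoint (w : StarWord g) : adjoint (adjoint w) = w := by
  apply FreeMonoid.toList.injective
  simp [adjoint, List.map_reverse, Function.comp_def, StarLetter.adjoint_adjoint]

theorem adjoint_mul (v w : StarWord g) : adjoint (v * w) = adjoint w * adjoint v := by
  apply FreeMonoid.toList.injective
  simp [adjoint, FreeMonoid.toList_mul]

/-- `StarWord.adjoint` as a permutation of the set of words. -/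
def adjointEquiv : StarWord g ≃ StarWord g where
  toFun := adjoint
  invFun := adjoint
  left_inv := adjoint_adjoint
  right_inv := adjoint_adjoint

end StarWord

/-- The free star-algebra on `x_1, …, x_g`: the finite `𝕜`-linear combinations of words in the
letters `x_j, x_j*`, multiplied by concatenation of words. -/
abbrev FreeStarAlgebra (𝕜 : Type*) [RCLike 𝕜] (g : ℕ) : Type _ :=
  MonoidAlgebra 𝕜 (StarWord g)

namespace FreeStarAlgebra

variable {𝕜 : Type*} [RCLike 𝕜] {g : ℕ}

/-- The involution `(∑ c_w w)* = ∑ (conj c_w) w*`. -/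
noncomputable instance instStar : Star (FreeStarAlgebra 𝕜 g) where
  star p := MonoidAlgebra.ofCoeff
    ((p.coeff.mapRange star (star_zero 𝕜)).equivMapDomain StarWord.adjointEquiv)

theorem coeff_star (p : FreeStarAlgebra 𝕜 g) (w : StarWord g) :
    (star p).coeff w = star (p.coeff w.adjoint) :=
  rfl

theorem star_single (w : StarWord g) (c : 𝕜) :
    star (MonoidAlgebra.single w c : FreeStarAlgebra 𝕜 g) =
      MonoidAlgebra.single w.adjoint (star c) := by
  change MonoidAlgebra.ofCoeff (Finsupp.equivMapDomain StarWord.adjointEquiv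
    (Finsupp.mapRange star (star_zero 𝕜) (Finsupp.single w c))) = _
  rw [Finsupp.mapRange_single, Finsupp.equivMapDomain_single]
  rfl

noncomputable instance instStarAddMonoid : StarAddMonoid (FreeStarAlgebra 𝕜 g) where
  star_involutive p := by
    apply MonoidAlgebra.coeff_injective
    ext w
    rw [coeff_star, coeff_star, star_star, StarWord.adjoint_adjoint]
  star_add p q := by
    apply MonoidAlgebra.coeff_injective
    ext w
    simp only [coeff_star, MonoidAlgebra.coeff_add, Finsupp.add_apply, star_add]

noncomputable instance instStarRing : StarRing (FreeStarAlgebra 𝕜 g) where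
  star_mul p q := by
    induction p using MonoidAlgebra.induction_linear with
    | zero => simp
    | add p₁ p₂ h₁ h₂ => rw [add_mul, star_add, h₁, h₂, star_add, mul_add]
    | single v c =>
      induction q using MonoidAlgebra.induction_linear with
      | zero => simp
      | add q₁ q₂ h₁ h₂ => rw [mul_add, star_add, h₁, h₂, star_add, add_mul]
      | single w d =>
        simp only [MonoidAlgebra.single_mul_single, star_single, StarWord.adjoint_mul, star_mul]
  star_add := star_add

instance instStarModule : StarModule 𝕜 (FreeStarAlgebra 𝕜 g) where
  star_smul c p := by
    apply MonoidAlgebra.coeff_injective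
    ext w
    simp [coeff_star]

/-- The variable `x_j` as an element of the free star-algebra (its adjoint is `star (X j)`). -/
noncomputable def X (j : Fin g) : FreeStarAlgebra 𝕜 g :=
  MonoidAlgebra.single (FreeMonoid.of (StarLetter.x j)) 1

variable (𝕜 g) in
/-- The analytic polynomials: the polynomials in the variables `x_1, …, x_g` only, i.e. the unital
subalgebra generated by the `x_j` (without the `x_j*`). -/
noncomputable def analyticPolynomials : Subalgebra 𝕜 (FreeStarAlgebra 𝕜 g) :=
  Algebra.adjoin 𝕜 (Set.range (X : Fin g → FreeStarAlgebra 𝕜 g))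

end FreeStarAlgebra

/-! ### Faithful positive functionals from triangular families -/

section FaithfulFunctional

open Finset

/-! Let `A` be the quotient, assumed nonzero. Each defining relation involves only the `x_j` or,
after applying the star, only the `x_j*`. So `A` is the free product of the image `B` of the
analytic polynomials and of its star `B*`. Take a basis of `B` that contains `1` and is adapted to
the degree filtration; its star is such a basis of `B*`. The alternating products of basis elements
other than `1` form a basis of `A`.

For an alternating word `w` let `φ_w` be the coefficient of `w* w`. If `φ_w (u* v) ≠ 0`, then `u = v
= w` or the rank of `w` is below that of `u` or `v`, where the rank is total degree plus squared
length. In the order of rank, `φ_w` thus contributes to the Gram matrix of the words up to `w` only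
the diagonal entry at `w`. Hence `∑ c_w φ_w`, with the `c_w` chosen recursively and large, has a
Gram matrix dominated by its diagonal and is positive and faithful on `A`
(`exists_faithful_positive_of_triangular`). Its pullback is `L`, and the GNS construction gives the
representation.

The normal form in the free product is obtained by van der Waerden's method: `A` acts on the span of
the alternating words (`SubalgebraPair.act`), and coefficients are read off from the action on the
empty word (`exists_faithful_positive_of_subalgebraPair`). The action descends to the quotient
because the relations are analytic (`FreeStarAlgebra.exists_faithful_positive_quotient`). -/

theorem exists_strong_recursion {β : Type*} [Inhabited β] (P : ℕ → (ℕ → β) → β)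
    (hP : ∀ n c c', (∀ m < n, c m = c' m) → P n c = P n c') :
    ∃ c : ℕ → β, ∀ n, c n = P n c := by
  let F : (n : ℕ) → ((m : ℕ) → m < n → β) → β :=
    -- The value `default` at indices `m ≥ n` is harmless, since `P n` depends only on the values
    -- below `n`.
    fun n r => P n (fun m => if h : m < n then r m h else default)
  refine ⟨WellFounded.fix Nat.lt_wfRel.wf F, fun n => ?_⟩
  rw [WellFounded.fix_eq]
  exact hP _ _ _ fun m hm => by simp [hm]

variable {𝕜 : Type*} [RCLike 𝕜]

/-- A hermitian matrix whose diagonal entries dominate the part of their columns above the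
diagonal is positive definite. -/
theorem le_re_sum_of_diagonal_dominant (G : ℕ → ℕ → 𝕜) (hG : ∀ i j, G j i = star (G i j))
    (a : ℕ → 𝕜)
    (h : ∀ n, a n ≠ 0 → 2 + 2 ^ (n + 1) * ∑ i ∈ range n, ‖G i n‖ ^ 2 ≤ RCLike.re (G n n)) (n : ℕ) :
    (1 + (1 / 2 : ℝ) ^ n) * ∑ i ∈ range n, ‖a i‖ ^ 2 ≤
      RCLike.re (∑ i ∈ range n, ∑ j ∈ range n, star (a i) * a j * G i j) := by
  induction n with
  | zero => simp
  | succ n ih =>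
    have hsplit : RCLike.re (∑ i ∈ range (n + 1), ∑ j ∈ range (n + 1), star (a i) * a j * G i j) =
        RCLike.re (∑ i ∈ range n, ∑ j ∈ range n, star (a i) * a j * G i j) +
        ∑ i ∈ range n, 2 * RCLike.re (star (a i) * a n * G i n) +
        RCLike.re (G n n) * ‖a n‖ ^ 2 := by
      have h1 : ∀ i, RCLike.re (star (a n) * a i * G n i) =
          RCLike.re (star (a i) * a n * G i n) := by
        intro i
        rw [hG i n, ← RCLike.conj_re]
        simp only [RCLike.star_def, map_mul, RCLike.conj_conj]
        ring_nf
      have h2 : RCLike.re (star (a n) * a n * G n n) = RCLike.re (G n n) * ‖a n‖ ^ 2 := by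
        rw [RCLike.star_def, RCLike.conj_mul, ← RCLike.ofReal_pow, RCLike.re_ofReal_mul, mul_comm]
      rw [sum_range_succ, sum_range_succ]
      simp only [sum_range_succ, sum_add_distrib, map_add, h2]
      simp only [map_sum, h1, ← mul_sum]
      ring
    rw [hsplit, sum_range_succ]
    -- AM-GM with weight `2^-(n+1)`: the cross terms consume half of the slack `2^-n`. Their cost in
    -- `‖a n‖ ^ 2` is paid by the diagonal entry, whose summand `2` covers the remaining `1 +
    -- 2^-(n+1)`.
    have hcross : -((1 / 2 : ℝ) ^ (n + 1) * ∑ i ∈ range n, ‖a i‖ ^ 2 +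
        2 ^ (n + 1) * (∑ i ∈ range n, ‖G i n‖ ^ 2) * ‖a n‖ ^ 2) ≤
        ∑ i ∈ range n, 2 * RCLike.re (star (a i) * a n * G i n) := by
      rw [mul_sum, mul_sum, sum_mul, ← sum_add_distrib, ← sum_neg_distrib]
      refine sum_le_sum fun i _ => ?_
      have h3 : |RCLike.re (star (a i) * a n * G i n)| ≤ ‖a i‖ * (‖a n‖ * ‖G i n‖) := by
        refine (RCLike.abs_re_le_norm _).trans ?_
        rw [norm_mul, norm_mul, norm_star, mul_assoc]
      have h4 := (abs_le.1 h3).1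
      set t : ℝ := (1 / 2 : ℝ) ^ (n + 1) with ht
      have h5 : t * 2 ^ (n + 1) = 1 := by rw [ht, ← mul_pow]; norm_num
      have h6 : 0 < t := by positivity
      have h7 : 0 ≤ 2 ^ (n + 1) * (t * ‖a i‖ - ‖a n‖ * ‖G i n‖) ^ 2 := by positivity
      have h8 : 2 ^ (n + 1) * (t * ‖a i‖ - ‖a n‖ * ‖G i n‖) ^ 2 =
          (t * 2 ^ (n + 1)) * (t * ‖a i‖ ^ 2) - 2 * (t * 2 ^ (n + 1)) *
            (‖a i‖ * (‖a n‖ * ‖G i n‖)) + 2 ^ (n + 1) * ‖G i n‖ ^ 2 * ‖a n‖ ^ 2 := by ring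
      rw [h5] at h8
      linarith
    have hdiag : 2 * ‖a n‖ ^ 2 + 2 ^ (n + 1) * (∑ i ∈ range n, ‖G i n‖ ^ 2) * ‖a n‖ ^ 2 ≤
        RCLike.re (G n n) * ‖a n‖ ^ 2 := by
      by_cases hn : a n = 0
      · simp [hn]
      · rw [← add_mul]
        exact mul_le_mul_of_nonneg_right (h n hn) (by positivity)
    have h9 : (1 / 2 : ℝ) ^ (n + 1) ≤ 1 := pow_le_one₀ (by norm_num) (by norm_num)
    have h10 : (1 / 2 : ℝ) ^ n = 2 * (1 / 2 : ℝ) ^ (n + 1) := by rw [pow_succ]; ring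
    rw [h10] at ih
    have h11 : (1 / 2 : ℝ) ^ (n + 1) * ‖a n‖ ^ 2 ≤ 1 * ‖a n‖ ^ 2 :=
      mul_le_mul_of_nonneg_right h9 (by positivity)
    linarith

variable {A : Type*} [Ring A] [StarRing A] [Algebra 𝕜 A] [StarModule 𝕜 A]

/-- The hermitian part of a linear functional. -/
noncomputable def LinearMap.hermitianPart (φ : A →ₗ[𝕜] 𝕜) : A →ₗ[𝕜] 𝕜 where
  toFun a := (φ a + star (φ (star a))) / 2
  map_add' a b := by simp only [star_add, map_add]; ring
  map_smul' c a := by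
    simp only [star_smul, map_smul, smul_eq_mul, star_mul', star_star, RingHom.id_apply]; ring

theorem LinearMap.hermitianPart_apply (φ : A →ₗ[𝕜] 𝕜) (a : A) :
    φ.hermitianPart a = (φ a + star (φ (star a))) / 2 := rfl

theorem LinearMap.isHermitianFunctional_hermitianPart (φ : A →ₗ[𝕜] 𝕜) :
    φ.hermitianPart.IsHermitianFunctional := by
  intro a
  simp only [hermitianPart_apply, star_star, star_div₀, star_add, star_ofNat]
  ring

/-- The sum of a sequence of functionals of which only finitely many are nonzero at each point. -/
noncomputable def LinearMap.finsum (φ : ℕ → A →ₗ[𝕜] 𝕜)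
    (h : ∀ a, (Function.support fun m => φ m a).Finite) : A →ₗ[𝕜] 𝕜 where
  toFun a := ∑ᶠ m, φ m a
  map_add' a b := by
    simp only [map_add]
    exact finsum_add_distrib (h a) (h b)
  map_smul' c a := by
    simp only [map_smul, RingHom.id_apply]
    exact (smul_finsum' c (h a)).symm

open scoped ComplexOrder in
/-- If a spanning sequence `e` and functionals `φ` are triangular in the sense that `φ n` vanishes on
all `star (e i) * e j` with `i, j ≤ n` except for `i = j = n`, then some combination of the `φ n`
is a faithful positive functional. -/
theorem exists_faithful_positive_of_triangular (e : ℕ → A) (φ : ℕ → A →ₗ[𝕜] 𝕜)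
    (hspan : Submodule.span 𝕜 (Set.range e) = ⊤)
    (hone : ∀ n, e n ≠ 0 → φ n (star (e n) * e n) = 1)
    (hzero : ∀ n, ∀ i ≤ n, ∀ j ≤ n, ¬(i = n ∧ j = n) → φ n (star (e i) * e j) = 0) :
    ∃ L : A →ₗ[𝕜] 𝕜, L.IsHermitianFunctional ∧ L.IsPositiveFunctional ∧
      ∀ a, L (star a * a) = 0 → a = 0 := by
  -- Passing to hermitian parts preserves both conditions, since the star exchanges the entries `(i,
  -- j)` and `(j, i)`.
  wlog hherm : ∀ n, (φ n).IsHermitianFunctional generalizing φ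
  · refine this (fun n => (φ n).hermitianPart) (fun n hn => ?_) (fun n i hi j hj hij => ?_)
      (fun n => (φ n).isHermitianFunctional_hermitianPart)
    · rw [LinearMap.hermitianPart_apply, star_mul, star_star, hone n hn, star_one]
      norm_num
    · rw [LinearMap.hermitianPart_apply, star_mul, star_star, hzero n i hi j hj hij,
        hzero n j hj i hi (fun h => hij h.symm)]
      simp
  let H : ℕ → (ℕ → ℝ) → ℕ → ℕ → 𝕜 :=
    fun n c i j => ∑ m ∈ range n, (c m : 𝕜) * φ m (star (e i) * e j)
  -- Among the Gram entries with indices at most `n`, the weight `c n` affects only `(n, n)`. The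
  -- others are already fixed by earlier weights, so `c n` can be chosen to dominate them; its last
  -- summand absorbs what the earlier weights add to `(n, n)`.
  obtain ⟨c, hc⟩ := exists_strong_recursion
    (fun n c => 2 + 2 ^ (n + 1) * ∑ i ∈ range n, ‖H n c i n‖ ^ 2 + ‖H n c n n‖) (by
      intro n c c' h
      have : H n c = H n c' := by
        ext i j
        exact sum_congr rfl fun m hm => by rw [h m (mem_range.1 hm)]
      simp only [this])
  -- On `star (e i) * e j` only the functionals of index at most `max i j` survive, and every `a` is
  -- `star 1 * a`.
  have hfin : ∀ a, (Function.support fun m => ((c m : 𝕜) • φ m) a).Finite := by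
    intro a
    have key : ∀ x ∈ Submodule.span 𝕜 (Set.range e), ∀ y ∈ Submodule.span 𝕜 (Set.range e),
        (Function.support fun m => ((c m : 𝕜) • φ m) (star x * y)).Finite := by
      intro x hx y hy
      induction hx using Submodule.span_induction with
      | zero => simp
      | add u v _ _ hu hv =>
        refine (hu.union hv).subset ?_
        simp only [star_add, add_mul, map_add]
        exact Function.support_add _ _
      | smul r u _ hu =>
        refine hu.subset fun m hm hm' => hm ?_
        simp only [star_smul, smul_mul_assoc, map_smul]
        exact (congrArg _ hm').trans (smul_zero _)
      | mem u hu =>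
        obtain ⟨i, rfl⟩ := hu
        induction hy using Submodule.span_induction with
        | zero => simp
        | add u v _ _ hu hv =>
          refine (hu.union hv).subset ?_
          simp only [mul_add, map_add]
          exact Function.support_add _ _
        | smul r u _ hu =>
          refine hu.subset fun m hm hm' => hm ?_
          simp only [mul_smul_comm, map_smul]
          exact (congrArg _ hm').trans (smul_zero _)
        | mem u hu =>
          obtain ⟨j, rfl⟩ := hu
          refine (Set.finite_Iic (max i j)).subset fun m hm => ?_
          by_contra hlt
          simp only [Set.mem_Iic, not_le, max_lt_iff] at hlt
          refine hm ?_
          exact (congrArg _ (hzero m i hlt.1.le j hlt.2.le (by omega))).trans (mul_zero _)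
    have := key 1 (hspan ▸ Submodule.mem_top) a (hspan ▸ Submodule.mem_top)
    simpa using this
  let L : A →ₗ[𝕜] 𝕜 := LinearMap.finsum (fun m => (c m : 𝕜) • φ m) hfin
  have hLa : ∀ a, L a = ∑ᶠ m, (c m : 𝕜) * φ m a := fun a => rfl
  have hLherm : L.IsHermitianFunctional := by
    intro a
    rw [hLa, hLa]
    have h1 : star (∑ᶠ m, (c m : 𝕜) * φ m a) = ∑ᶠ m, star ((c m : 𝕜) * φ m a) :=
      (starAddEquiv (R := 𝕜)).toAddMonoidHom.map_finsum (hfin a)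
    rw [h1]
    refine finsum_congr fun m => ?_
    rw [hherm m a, star_mul', RCLike.star_def, RCLike.conj_ofReal]
  let G : ℕ → ℕ → 𝕜 := fun i j => L (star (e i) * e j)
  have hGherm : ∀ i j, G j i = star (G i j) := fun i j => by
    change L _ = star (L _)
    rw [← hLherm, star_mul, star_star]
  have hGsum : ∀ n, ∀ i ≤ n, ∀ j ≤ n, G i j = H (n + 1) c i j := by
    intro n i hi j hj
    change L _ = _
    rw [hLa]
    refine finsum_eq_sum_of_support_subset _ fun m hm => ?_
    by_contra hlt
    simp only [coe_range, Set.mem_Iio, not_lt] at hlt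
    refine hm ?_
    simp only
    rw [hzero m i (by omega) j (by omega) (by omega), mul_zero]
  have hGdom : ∀ n, e n ≠ 0 →
      2 + 2 ^ (n + 1) * ∑ i ∈ range n, ‖G i n‖ ^ 2 ≤ RCLike.re (G n n) := by
    intro n hn
    have h1 : ∀ i ∈ range n, G i n = H n c i n := by
      intro i hi
      have hi' := mem_range.1 hi
      rw [hGsum n i hi'.le n le_rfl]
      simp only [H]
      rw [sum_range_succ, hzero n i hi'.le n le_rfl (by omega), mul_zero, add_zero]
    have h2 : G n n = H n c n n + (c n : 𝕜) := by
      rw [hGsum n n le_rfl n le_rfl]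
      simp only [H]
      rw [sum_range_succ, hone n hn, mul_one]
    rw [sum_congr rfl fun i hi => by rw [h1 i hi], h2, map_add, RCLike.ofReal_re, hc n]
    have h3 := (abs_le.1 (RCLike.abs_re_le_norm (H n c n n))).1
    linarith
  have hreal : ∀ a, ((RCLike.re (L (star a * a)) : ℝ) : 𝕜) = L (star a * a) := by
    intro a
    rw [← RCLike.conj_eq_iff_re, ← RCLike.star_def, ← hLherm, star_mul, star_star]
  have hexp : ∀ x : A, ∃ (a : ℕ → 𝕜) (n : ℕ), x = ∑ i ∈ range n, a i • e i ∧
      ∑ i ∈ range n, ‖a i‖ ^ 2 ≤ RCLike.re (L (star x * x)) := by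
    intro x
    have hx : x ∈ Submodule.span 𝕜 (Set.range e) := hspan ▸ Submodule.mem_top
    obtain ⟨f, rfl⟩ := (Finsupp.mem_span_range_iff_exists_finsupp).1 hx
    classical
    -- Coefficients of vanishing `e i` are dropped because `hGdom` says nothing about those indices.
    let a : ℕ → 𝕜 := fun i => if e i = 0 then 0 else f i
    obtain ⟨n, hn⟩ : ∃ n, f.support ⊆ range n := by
      obtain ⟨n, hn⟩ := f.support.exists_nat_subset_range
      exact ⟨n, hn⟩
    have hsum : (f.sum fun i r => r • e i) = ∑ i ∈ range n, a i • e i := by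
      rw [Finsupp.sum_of_support_subset f hn _ (by simp)]
      refine sum_congr rfl fun i _ => ?_
      by_cases h : e i = 0 <;> simp [a, h]
    refine ⟨a, n, hsum, ?_⟩
    have hQ := le_re_sum_of_diagonal_dominant G hGherm a (fun m hm => hGdom m fun h0 => hm (by
      simp [a, h0])) n
    have hLG : L (star (∑ i ∈ range n, a i • e i) * ∑ i ∈ range n, a i • e i) =
        ∑ i ∈ range n, ∑ j ∈ range n, star (a i) * a j * G i j := by
      simp only [star_sum, sum_mul_sum, map_sum, star_smul, smul_mul_smul_comm, map_smul,
        smul_eq_mul, G]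
    rw [hsum, hLG]
    refine le_trans ?_ hQ
    have h1 : 0 ≤ ∑ i ∈ range n, ‖a i‖ ^ 2 := by positivity
    have h2 : 0 ≤ (1 / 2 : ℝ) ^ n := by positivity
    nlinarith
  refine ⟨L, hLherm, fun x => ?_, fun x hx => ?_⟩
  · obtain ⟨a, n, -, h⟩ := hexp x
    rw [← hreal x]
    exact RCLike.ofReal_nonneg.2 (le_trans (by positivity) h)
  · obtain ⟨a, n, h1, h2⟩ := hexp x
    rw [hx, map_zero] at h2
    have h3 : ∑ i ∈ range n, ‖a i‖ ^ 2 = 0 := le_antisymm h2 (by positivity)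
    rw [sum_eq_zero_iff_of_nonneg (fun i _ => by positivity)] at h3
    rw [h1]
    refine sum_eq_zero fun i hi => ?_
    have := h3 i hi
    rw [sq_eq_zero_iff, norm_eq_zero] at this
    rw [this, zero_smul]

/-- Version of `exists_faithful_positive_of_triangular` for a family indexed by a type with a rank
function that has finite sublevel sets. -/
theorem exists_faithful_positive_of_rank {N : Type*} (κ : N → ℕ) (hκ : ∀ k, {w | κ w ≤ k}.Finite)
    (e : N → A) (φ : N → A →ₗ[𝕜] 𝕜)
    (hspan : Submodule.span 𝕜 (Set.range e) = ⊤)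
    (hone : ∀ w, φ w (star (e w) * e w) = 1)
    (hzero : ∀ u v w, φ w (star (e u) * e v) ≠ 0 → (u = w ∧ v = w) ∨ κ w < max (κ u) (κ v)) :
    ∃ L : A →ₗ[𝕜] 𝕜, L.IsHermitianFunctional ∧ L.IsPositiveFunctional ∧
      ∀ a, L (star a * a) = 0 → a = 0 := by
  have hcount : Countable N := by
    have : (Set.univ : Set N) = ⋃ k, {w | κ w ≤ k} := by
      ext w
      simpa using ⟨κ w, le_rfl⟩
    rw [← Set.countable_univ_iff, this]
    exact Set.countable_iUnion fun k => (hκ k).countable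
  obtain ⟨enc, henc⟩ := exists_injective_nat N
  -- Ties in `κ` are broken by an arbitrary enumeration. Every element has finitely many
  -- predecessors, so `ν` below is its position.
  let r : N → ℕ ×ₗ ℕ := fun w => toLex (κ w, enc w)
  have hr : Function.Injective r := fun u v h => by
    have := congrArg (fun p => (ofLex p).2) h
    exact henc this
  have hfin : ∀ w, {u | r u < r w}.Finite := fun w => (hκ (κ w)).subset fun u hu => by
    rcases (Prod.Lex.toLex_lt_toLex.1 hu) with h | h
    · exact h.le
    · exact h.1.le
  let ν : N → ℕ := fun w => {u | r u < r w}.ncard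
  have hν : ∀ u v, r u < r v → ν u < ν v := fun u v h =>
    Set.ncard_lt_ncard ⟨fun t ht => lt_trans ht h, fun hsub => lt_irrefl (r u) (hsub h)⟩ (hfin v)
  have hνinj : Function.Injective ν := fun u v h => by
    rcases lt_trichotomy (r u) (r v) with h1 | h1 | h1
    · exact absurd h (hν _ _ h1).ne
    · exact hr h1
    · exact absurd h (hν _ _ h1).ne'
  have hνκ : ∀ u w, ν u ≤ ν w → κ u ≤ κ w := fun u w h => by
    by_contra hlt
    exact absurd (hν w u (Prod.Lex.toLex_lt_toLex.2 (Or.inl (not_le.1 hlt)))) (not_lt.2 h)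
  -- Positions that are not taken, as happens when `N` is finite, carry the vector zero.
  have hnot : ∀ n, (¬∃ w, ν w = n) → Function.extend ν e 0 n = 0 := fun n hn => by
    rw [Function.extend_apply' _ _ _ hn]; rfl
  refine exists_faithful_positive_of_triangular (Function.extend ν e 0) (Function.extend ν φ 0)
    ?_ ?_ ?_
  · rw [eq_top_iff, ← hspan]
    refine Submodule.span_mono ?_
    rintro _ ⟨w, rfl⟩
    exact ⟨ν w, hνinj.extend_apply _ _ _⟩
  · intro n hn
    obtain ⟨w, rfl⟩ : ∃ w, ν w = n := by
      by_contra h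
      exact hn (hnot n h)
    rw [hνinj.extend_apply, hνinj.extend_apply, hone]
  · intro n i hi j hj hij
    by_cases hn : ∃ w, ν w = n
    · by_cases hi' : ∃ u, ν u = i
      · by_cases hj' : ∃ v, ν v = j
        · obtain ⟨w, rfl⟩ := hn
          obtain ⟨u, rfl⟩ := hi'
          obtain ⟨v, rfl⟩ := hj'
          simp only [hνinj.extend_apply]
          by_contra h
          rcases hzero u v w h with h | h
          · exact hij ⟨congrArg ν h.1, congrArg ν h.2⟩
          · exact absurd h (not_lt.2 (max_le (hνκ _ _ hi) (hνκ _ _ hj)))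
        · rw [hnot j hj', mul_zero, map_zero]
      · rw [hnot i hi', star_zero, zero_mul, map_zero]
    · rw [Function.extend_apply' _ _ _ hn]; rfl

end FaithfulFunctional
-- Bases adapted to a filtration
section AdaptedBasis

universe w

variable {K : Type*} {V : Type w} [Field K] [AddCommGroup V] [Module K V]

/-- Given an exhaustive filtration of a space by finitely generated subspaces which starts with a
line spanned by `v`, there is a linearly independent family that contains `v` and is adapted to
the filtration. -/
theorem exists_adapted_family (v : V) (hv : v ≠ 0) (F : ℕ → Submodule K V) (hmono : Monotone F)
    (hfg : ∀ n, (F n).FG) (hF0 : F 0 = Submodule.span K {v}) :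
    ∃ (J : Type w) (b : J → V) (deg : J → ℕ),
      LinearIndependent K (fun o : Option J => o.elim v b) ∧
      (∀ k, b k ∈ F (deg k)) ∧
      (∀ n, F n ≤ Submodule.span K (insert v (b '' {k | deg k ≤ n}))) ∧
      ∀ n, {k | deg k ≤ n}.Finite := by
  -- Each basis of `F n` is enlarged to one of `F (n + 1)`, so the bases form a chain and their
  -- union is independent.
  have hext : ∀ n (S : Set V), LinearIndepOn K id S ∧ Submodule.span K S = F n →
      ∃ T : Set V, S ⊆ T ∧ LinearIndepOn K id T ∧ Submodule.span K T = F (n + 1) := by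
    rintro n S ⟨hS, hspan⟩
    have hsub : S ⊆ (F (n + 1) : Set V) := fun s hs =>
      hmono (Nat.le_succ n) (hspan ▸ Submodule.subset_span hs)
    obtain ⟨T, hT, hST, hFT, hli⟩ :=
      exists_linearIndepOn_extension (K := K) (v := id) hS hsub
    rw [Set.image_id, Set.image_id] at hFT
    exact ⟨T, hST, hli, le_antisymm (Submodule.span_le.2 hT) (fun x hx => hFT hx)⟩
  choose T hT using hext
  let S : (n : ℕ) → {S : Set V // LinearIndepOn K id S ∧ Submodule.span K S = F n} := fun n =>
    Nat.rec ⟨{v}, LinearIndepOn.singleton hv, hF0.symm⟩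
      (fun n S => ⟨T n S.1 S.2, (hT n S.1 S.2).2⟩) n
  have hSmono : Monotone fun n => (S n).1 :=
    monotone_nat_of_le_succ fun n => (hT n (S n).1 (S n).2).1
  have hvS : ∀ n, v ∈ (S n).1 := fun n => hSmono (Nat.zero_le n) (Set.mem_singleton v)
  have hli : LinearIndepOn K id (⋃ n, (S n).1) :=
    linearIndepOn_iUnion_of_directed hSmono.directed_le fun n => (S n).2.1
  let J : Type w := {s : V // s ∈ (⋃ n, (S n).1) ∧ s ≠ v}
  have hex : ∀ k : J, ∃ n, k.1 ∈ (S n).1 := fun k => Set.mem_iUnion.1 k.2.1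
  classical
  -- The degree of a basis vector is the first stage at which it occurs.
  have hdeg : ∀ (k : J) n, Nat.find (hex k) ≤ n ↔ k.1 ∈ (S n).1 := fun k n =>
    ⟨fun h => hSmono h (Nat.find_spec (hex k)), fun h => Nat.find_min' _ h⟩
  refine ⟨J, Subtype.val, fun k => Nat.find (hex k), ?_, ?_, ?_, ?_⟩
  · let f : Option J → (⋃ n, (S n).1 : Set V) := fun o =>
      o.elim ⟨v, Set.mem_iUnion.2 ⟨0, hvS 0⟩⟩ fun k => ⟨k.1, k.2.1⟩
    have hf : Function.Injective f := by
      rintro (_ | k) (_ | k') h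
      · rfl
      · exact absurd (congrArg Subtype.val h).symm k'.2.2
      · exact absurd (congrArg Subtype.val h) k.2.2
      · exact congrArg some (Subtype.ext (congrArg (fun s => s.1) h :))
    have := LinearIndependent.comp hli f hf
    convert this using 1
    ext (_ | k) <;> rfl
  · intro k
    rw [← (S _).2.2]
    exact Submodule.subset_span (Nat.find_spec (hex k))
  · intro n
    rw [← (S n).2.2]
    refine Submodule.span_mono fun s hs => ?_
    by_cases h : s = v
    · exact Or.inl h
    · exact Or.inr ⟨⟨s, Set.mem_iUnion.2 ⟨n, hs⟩, h⟩, (hdeg _ n).2 hs, rfl⟩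
  · intro n
    have hfin : (S n).1.Finite := by
      have hle : Submodule.span K (S n).1 ≤ F n := (S n).2.2.le
      have : Module.Finite K (F n) := Module.Finite.iff_fg.2 (hfg n)
      have hli' : LinearIndependent K
          (fun s : (S n).1 => (⟨s.1, hle (Submodule.subset_span s.2)⟩ : F n)) :=
        LinearIndependent.of_comp (F n).subtype (S n).2.1
      have := hli'.finite_of_isNoetherian
      exact Set.toFinite _
    refine (hfin.preimage Subtype.val_injective.injOn).subset fun k hk => ?_
    exact (hdeg k n).1 hk

end AdaptedBasis
/-! ## Alternating words -/

/-- The words in two copies of an alphabet `J` (marked by a `Bool`) in which the two copies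
alternate. A nonempty word is given by the copy of its first letter and its letters. -/
abbrev AltWord (J : Type*) : Type _ := Option (Bool × J × List J)

namespace AltWord

variable {J : Type*}

/-- The alternating word that starts in the copy `τ` and has the given letters. -/
def ofList (τ : Bool) : List J → AltWord J
  | [] => none
  | k :: l => some (τ, k, l)

theorem exists_eq_ofList (w : AltWord J) : ∃ τ l, w = ofList τ l := by
  rcases w with _ | ⟨τ, k, l⟩
  · exact ⟨true, [], rfl⟩
  · exact ⟨τ, k :: l, rfl⟩

theorem ofList_nil_eq (σ τ : Bool) : ofList σ ([] : List J) = ofList τ [] := rfl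

theorem ofList_eq_ofList {σ τ : Bool} {l m : List J} (h : ofList σ l = ofList τ m) :
    l = m ∧ (l ≠ [] → σ = τ) := by
  cases l <;> cases m <;> simp_all [ofList]

/-- The number of letters. -/
def len : AltWord J → ℕ
  | none => 0
  | some (_, _, l) => l.length + 1

@[simp]
theorem len_ofList (τ : Bool) (l : List J) : len (ofList τ l) = l.length := by
  cases l <;> rfl

/-- The sum of the degrees of the letters. -/
def weight (deg : J → ℕ) : AltWord J → ℕ
  | none => 0
  | some (_, k, l) => ((k :: l).map deg).sum

@[simp]
theorem weight_ofList (deg : J → ℕ) (τ : Bool) (l : List J) :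
    weight deg (ofList τ l) = (l.map deg).sum := by
  cases l <;> rfl

/-- Letters of degree zero are allowed, so the weight alone does not bound the length; the squared
length does. -/
theorem finite_setOf_weight_add_sq_len_le (deg : J → ℕ) (hdeg : ∀ n, {k | deg k ≤ n}.Finite)
    (n : ℕ) : {w : AltWord J | weight deg w + len w ^ 2 ≤ n}.Finite := by
  have hfin : {l : List J | l.length ≤ n ∧ ∀ k ∈ l, deg k ≤ n}.Finite := by
    have := (hdeg n).to_subtype
    refine ((List.finite_length_le {k | deg k ≤ n} n).image (List.map Subtype.val)).subset ?_
    rintro l ⟨h1, h2⟩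
    exact ⟨l.attach.map fun k => ⟨k.1, h2 k.1 k.2⟩, (List.length_map _).trans_le (List.length_attach.trans_le h1), by simp⟩
  refine ((Set.finite_univ.prod hfin).image fun p : Bool × List J => ofList p.1 p.2).subset ?_
  intro w hw
  obtain ⟨τ, l, rfl⟩ := exists_eq_ofList w
  simp only [Set.mem_ofPred_eq, weight_ofList, len_ofList] at hw
  refine ⟨(τ, l), ⟨trivial, show l.length ≤ n from ?_, fun k (hk : k ∈ l) => ?_⟩, rfl⟩
  · have := Nat.le_self_pow two_ne_zero l.length
    omega
  · have := List.single_le_sum (fun _ _ => Nat.zero_le _) _ (List.mem_map_of_mem (f := deg) hk)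
    omega

/-- The copy that follows the last letter of an alternating word which starts in the copy `τ`. -/
def endCopy (τ : Bool) : List J → Bool
  | [] => τ
  | _ :: l => endCopy (!τ) l

/-- This lets the starting copy of `w` be recovered from `w* w`. -/
theorem endCopy_injective (l : List J) : Function.Injective fun τ => endCopy τ l := by
  induction l with
  | nil => exact fun _ _ h => h
  | cons k l ih => exact fun σ τ h => Bool.not_inj (ih h)

/-- The word `w* w`, where `w*` is `w` reversed with the two copies interchanged. -/
def starMulSelf : AltWord J → AltWord J
  | none => none
  | some (τ, k, l) => ofList (endCopy τ (k :: l)) ((k :: l).reverse ++ k :: l)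

theorem starMulSelf_ofList (τ : Bool) (l : List J) :
    starMulSelf (ofList τ l) = ofList (endCopy τ l) (l.reverse ++ l) := by
  cases l <;> rfl

/-- Put at most one letter of the copy `τ` in front of a word that does not start in `τ`. -/
def consOption (τ : Bool) (l : List J) : Option J → AltWord J
  | none => ofList (!τ) l
  | some k => ofList τ (k :: l)

end AltWord

/-! ## The action on the span of the alternating words -/

/-- Two subalgebras of `A`, each with a basis that consists of `1` and a family indexed by `J`;
`coord` gives the coordinates with respect to this basis, on the subalgebra. -/
structure SubalgebraPair (𝕜 A J : Type*) [Field 𝕜] [Ring A] [Algebra 𝕜 A] where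
  basis : Bool → J → A
  alg : Bool → Subalgebra 𝕜 A
  coord : Bool → A →ₗ[𝕜] (Option J →₀ 𝕜)
  basis_mem : ∀ τ k, basis τ k ∈ alg τ
  le_span : ∀ τ, Subalgebra.toSubmodule (alg τ) ≤
    Submodule.span 𝕜 (insert 1 (Set.range (basis τ)))
  coord_one : ∀ τ, coord τ 1 = Finsupp.single none 1
  coord_basis : ∀ τ k, coord τ (basis τ k) = Finsupp.single (some k) 1

namespace SubalgebraPair

open AltWord

variable {𝕜 A J : Type*} [Field 𝕜] [Ring A] [Algebra 𝕜 A] (D : SubalgebraPair 𝕜 A J)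

/-- For `b` in the subalgebra `τ`, the expansion of `b * l` into alternating words, where `l` does
not start in `τ`. -/
noncomputable def consMap (τ : Bool) (l : List J) : A →ₗ[𝕜] (AltWord J →₀ 𝕜) :=
  Finsupp.lmapDomain 𝕜 𝕜 (consOption τ l) ∘ₗ D.coord τ

theorem consMap_one (τ : Bool) (l : List J) :
    D.consMap τ l 1 = Finsupp.single (ofList (!τ) l) 1 := by
  simp [consMap, D.coord_one, consOption]

theorem consMap_basis (τ : Bool) (l : List J) (k : J) :
    D.consMap τ l (D.basis τ k) = Finsupp.single (ofList τ (k :: l)) 1 := by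
  simp [consMap, D.coord_basis, consOption]

/-- The action of the subalgebra `τ` on an alternating word. -/
noncomputable def actWord (τ : Bool) : AltWord J → A →ₗ[𝕜] (AltWord J →₀ 𝕜)
  | none => D.consMap τ []
  | some (σ, k, l) =>
    if σ = τ then D.consMap τ l ∘ₗ LinearMap.mulRight 𝕜 (D.basis τ k) else D.consMap τ (k :: l)

/-- The action of the subalgebra `τ` on the span of the alternating words. -/
noncomputable def act (τ : Bool) : A →ₗ[𝕜] Module.End 𝕜 (AltWord J →₀ 𝕜) :=
  (Finsupp.linearCombination 𝕜 (D.actWord τ)).flip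

theorem act_single (τ : Bool) (a : A) (w : AltWord J) :
    D.act τ a (Finsupp.single w 1) = D.actWord τ w a := by
  simp [act]

theorem act_single_ofList_not (τ : Bool) (a : A) (l : List J) :
    D.act τ a (Finsupp.single (ofList (!τ) l) 1) = D.consMap τ l a := by
  rw [act_single]
  cases l with
  | nil => rfl
  | cons k l => simp [ofList, actWord]

theorem act_single_ofList_cons (τ : Bool) (a : A) (k : J) (l : List J) :
    D.act τ a (Finsupp.single (ofList τ (k :: l)) 1) = D.consMap τ l (a * D.basis τ k) := by
  rw [act_single]
  simp [ofList, actWord]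

theorem eq_of_mem_alg {P : Type*} [AddCommGroup P] [Module 𝕜 P] {f f' : A →ₗ[𝕜] P} {τ : Bool}
    (h1 : f 1 = f' 1) (hb : ∀ k, f (D.basis τ k) = f' (D.basis τ k)) {b : A}
    (h : b ∈ D.alg τ) : f b = f' b := by
  refine LinearMap.eqOn_span' (s := insert 1 (Set.range (D.basis τ))) ?_ (D.le_span τ h)
  rintro _ (rfl | ⟨k, rfl⟩)
  · exact h1
  · exact hb k

/-- Both sides are linear in `b`, and for `b = 1` or a basis element the equation is the definition
of the action. Outside the subalgebra `coord` is an arbitrary extension, so `b` must lie in it,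
whereas `a` need not. -/
theorem act_consMap (τ : Bool) (a : A) {b : A} (hb : b ∈ D.alg τ) (l : List J) :
    D.act τ a (D.consMap τ l b) = D.consMap τ l (a * b) := by
  refine D.eq_of_mem_alg (f := D.act τ a ∘ₗ D.consMap τ l)
    (f' := D.consMap τ l ∘ₗ LinearMap.mulLeft 𝕜 a) ?_ (fun k => ?_) hb
  · simp [consMap_one, act_single_ofList_not]
  · simp [consMap_basis, act_single_ofList_cons]

theorem end_ext {P : Type*} [AddCommGroup P] [Module 𝕜 P] {f f' : (AltWord J →₀ 𝕜) →ₗ[𝕜] P}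
    (τ : Bool) (h1 : ∀ l, f (Finsupp.single (ofList (!τ) l) 1) =
      f' (Finsupp.single (ofList (!τ) l) 1))
    (h2 : ∀ k l, f (Finsupp.single (ofList τ (k :: l)) 1) =
      f' (Finsupp.single (ofList τ (k :: l)) 1)) : f = f' := by
  refine Finsupp.lhom_ext' fun w => LinearMap.ext_ring ?_
  rcases w with _ | ⟨σ, k, l⟩
  · exact h1 []
  · by_cases h : σ = τ
    · subst h
      exact h2 k l
    · obtain rfl : σ = !τ := Bool.eq_not_iff.2 h
      exact h1 (k :: l)

theorem act_one (τ : Bool) : D.act τ 1 = 1 := by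
  refine end_ext τ (fun l => ?_) fun k l => ?_
  · rw [act_single_ofList_not, consMap_one, Module.End.one_apply]
  · rw [act_single_ofList_cons, one_mul, consMap_basis, Module.End.one_apply]

theorem act_mul (τ : Bool) (a : A) {b : A} (hb : b ∈ D.alg τ) :
    D.act τ (a * b) = D.act τ a * D.act τ b := by
  refine end_ext τ (fun l => ?_) fun k l => ?_
  · rw [Module.End.mul_apply, act_single_ofList_not, act_single_ofList_not, act_consMap _ _ _ hb]
  · rw [Module.End.mul_apply, act_single_ofList_cons, act_single_ofList_cons,
      act_consMap _ _ _ (mul_mem hb (D.basis_mem τ k)), mul_assoc]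

/-- The product of the letters of the alternating word that starts in the copy `τ`. -/
def listVal (τ : Bool) : List J → A
  | [] => 1
  | k :: l => D.basis τ k * listVal (!τ) l

/-- The product of the letters of an alternating word. -/
def val : AltWord J → A
  | none => 1
  | some (τ, k, l) => D.listVal τ (k :: l)

theorem val_ofList (τ : Bool) (l : List J) : D.val (ofList τ l) = D.listVal τ l := by
  cases l <;> rfl

theorem linearCombination_val_consMap (τ : Bool) (l : List J) {b : A} (hb : b ∈ D.alg τ) :
    Finsupp.linearCombination 𝕜 D.val (D.consMap τ l b) = b * D.listVal (!τ) l := by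
  refine D.eq_of_mem_alg (f := Finsupp.linearCombination 𝕜 D.val ∘ₗ D.consMap τ l)
    (f' := LinearMap.mulRight 𝕜 (D.listVal (!τ) l)) ?_ (fun k => ?_) hb
  · simp [consMap_one, val_ofList]
  · simp [consMap_basis, val_ofList, listVal]

theorem linearCombination_val_act (τ : Bool) {a : A} (ha : a ∈ D.alg τ) (m : AltWord J →₀ 𝕜) :
    Finsupp.linearCombination 𝕜 D.val (D.act τ a m) =
      a * Finsupp.linearCombination 𝕜 D.val m := by
  suffices h : Finsupp.linearCombination 𝕜 D.val ∘ₗ D.act τ a =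
      LinearMap.mulLeft 𝕜 a ∘ₗ Finsupp.linearCombination 𝕜 D.val from LinearMap.congr_fun h m
  refine end_ext τ (fun l => ?_) fun k l => ?_
  · simp [act_single_ofList_not, linearCombination_val_consMap D τ l ha, val_ofList]
  · simp [act_single_ofList_cons,
      linearCombination_val_consMap D τ l (mul_mem ha (D.basis_mem τ k)), val_ofList, listVal,
      mul_assoc]

/-- Evaluated at the empty word, this writes every `a` as a combination of products of alternating
words, so these span `A`. -/
theorem linearCombination_val_rep (π : A →ₐ[𝕜] Module.End 𝕜 (AltWord J →₀ 𝕜))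
    (hπ : ∀ τ, ∀ a ∈ D.alg τ, π a = D.act τ a)
    (hgen : Algebra.adjoin 𝕜 (⋃ τ, (D.alg τ : Set A)) = ⊤) (a : A) (m : AltWord J →₀ 𝕜) :
    Finsupp.linearCombination 𝕜 D.val (π a m) = a * Finsupp.linearCombination 𝕜 D.val m := by
  have ha : a ∈ Algebra.adjoin 𝕜 (⋃ τ, (D.alg τ : Set A)) := hgen ▸ Algebra.mem_top
  induction ha using Algebra.adjoin_induction generalizing m with
  | mem a ha =>
    obtain ⟨τ, ha⟩ := Set.mem_iUnion.1 ha
    rw [hπ τ a ha, D.linearCombination_val_act τ ha]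
  | algebraMap r => simp [Algebra.algebraMap_eq_smul_one]
  | add x y _ _ hx hy => rw [map_add, LinearMap.add_apply, map_add, hx, hy, add_mul]
  | mul x y _ _ hx hy => rw [map_mul, Module.End.mul_apply, hx, hy, mul_assoc]

theorem rep_listVal (π : A →ₐ[𝕜] Module.End 𝕜 (AltWord J →₀ 𝕜))
    (hπ : ∀ τ, ∀ a ∈ D.alg τ, π a = D.act τ a) (τ : Bool) (l : List J) :
    π (D.listVal τ l) (Finsupp.single none 1) = Finsupp.single (ofList τ l) 1 := by
  induction l generalizing τ with
  | nil => simp [listVal, ofList]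
  | cons k l ih =>
    rw [listVal, map_mul, Module.End.mul_apply, ih, hπ τ _ (D.basis_mem τ k),
      act_single_ofList_not, consMap_basis]

/-- The starred word ends in the copy `!τ`, so in front of a word starting in `τ` nothing merges and
the words are simply concatenated. -/
theorem rep_star_listVal [StarRing A] (π : A →ₐ[𝕜] Module.End 𝕜 (AltWord J →₀ 𝕜))
    (hπ : ∀ τ, ∀ a ∈ D.alg τ, π a = D.act τ a)
    (hstar : ∀ τ k, star (D.basis τ k) = D.basis (!τ) k) (τ : Bool) (l l' : List J) :
    π (star (D.listVal τ l)) (Finsupp.single (ofList τ l') 1) =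
      Finsupp.single (ofList (endCopy τ l) (l.reverse ++ l')) 1 := by
  induction l generalizing τ l' with
  | nil => simp [listVal, endCopy]
  | cons k l ih =>
    have h := D.act_single_ofList_not (!τ) (D.basis (!τ) k) l'
    rw [Bool.not_not] at h
    rw [listVal, star_mul, hstar, map_mul, Module.End.mul_apply, hπ _ _ (D.basis_mem _ k), h,
      consMap_basis, ih, endCopy, List.reverse_cons, List.append_assoc, List.singleton_append]

/-- The span of the alternating words of weight at most `d` and length at most `n`. -/
noncomputable def bounded (𝕜 : Type*) {J : Type*} [Field 𝕜] (deg : J → ℕ) (d n : ℕ) :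
    Submodule 𝕜 (AltWord J →₀ 𝕜) :=
  Finsupp.supported 𝕜 𝕜 {w | weight deg w ≤ d ∧ len w ≤ n}

theorem single_mem_bounded {deg : J → ℕ} {d n : ℕ} {τ : Bool} {l : List J}
    (hd : (l.map deg).sum ≤ d) (hn : l.length ≤ n) :
    Finsupp.single (ofList τ l) (1 : 𝕜) ∈ bounded 𝕜 deg d n :=
  Finsupp.single_mem_supported 𝕜 1 (by simp [hd, hn])

theorem consMap_mem_bounded {deg : J → ℕ} {τ : Bool} {l : List J} {d e : ℕ} {b : A}
    (hb : b ∈ Submodule.span 𝕜 (insert 1 (D.basis τ '' {k | deg k ≤ e})))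
    (hd : e + (l.map deg).sum ≤ d) :
    D.consMap τ l b ∈ bounded 𝕜 deg d (l.length + 1) := by
  have h : Submodule.span 𝕜 (insert 1 (D.basis τ '' {k | deg k ≤ e})) ≤
      (bounded 𝕜 deg d (l.length + 1)).comap (D.consMap τ l) := by
    rw [Submodule.span_le]
    rintro _ (rfl | ⟨k, hk, rfl⟩)
    · simp only [Submodule.comap_coe, Set.mem_preimage, SetLike.mem_coe, consMap_one]
      exact single_mem_bounded (by omega) (by omega)
    · have hk' : deg k ≤ e := hk
      simp only [Submodule.comap_coe, Set.mem_preimage, SetLike.mem_coe, consMap_basis]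
      exact single_mem_bounded (by simp; omega) (by simp)
  exact h hb

theorem bounded_mono (deg : J → ℕ) {d d' n n' : ℕ} (hd : d ≤ d') (hn : n ≤ n') :
    bounded 𝕜 deg d n ≤ bounded 𝕜 deg d' n' :=
  Finsupp.supported_mono fun _ hw => ⟨hw.1.trans hd, hw.2.trans hn⟩

/-- The new letter is either prepended or merged with a first letter of the same copy; by `hmul`
merging does not exceed the sum of the degrees. -/
theorem act_basis_mem_bounded {deg : J → ℕ}
    (hmul : ∀ τ i j, D.basis τ i * D.basis τ j ∈
      Submodule.span 𝕜 (insert 1 (D.basis τ '' {k | deg k ≤ deg i + deg j})))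
    (τ : Bool) (k : J) {d n : ℕ} {m : AltWord J →₀ 𝕜} (hm : m ∈ bounded 𝕜 deg d n) :
    D.act τ (D.basis τ k) m ∈ bounded 𝕜 deg (d + deg k) (n + 1) := by
  have h : bounded 𝕜 deg d n ≤
      (bounded 𝕜 deg (d + deg k) (n + 1)).comap (D.act τ (D.basis τ k)) := by
    rw [bounded, Finsupp.supported_eq_span_single, Submodule.span_le]
    rintro _ ⟨w, ⟨hd, hn⟩, rfl⟩
    simp only [Submodule.comap_coe, Set.mem_preimage, SetLike.mem_coe]
    have hnot : ∀ l : List J, (l.map deg).sum ≤ d → l.length ≤ n →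
        D.act τ (D.basis τ k) (Finsupp.single (ofList (!τ) l) 1) ∈
          bounded 𝕜 deg (d + deg k) (n + 1) := by
      intro l h1 h2
      rw [act_single_ofList_not, consMap_basis]
      exact single_mem_bounded (by simp; omega) (by simpa using h2)
    rcases w with _ | ⟨σ, k', l⟩
    · exact hnot [] (by simp) (by simp)
    · by_cases h : σ = τ
      · subst h
        change D.act σ _ (Finsupp.single (ofList σ (k' :: l)) 1) ∈ _
        rw [act_single_ofList_cons]
        simp only [weight, len, List.map_cons, List.sum_cons] at hd hn
        exact bounded_mono deg le_rfl (by omega)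
          (D.consMap_mem_bounded (d := d + deg k) (hmul σ k k') (by omega))
      · obtain rfl : σ = !τ := Bool.eq_not_iff.2 h
        exact hnot (k' :: l) hd hn
  exact h hm

theorem rep_star_listVal_mem_bounded [StarRing A] (π : A →ₐ[𝕜] Module.End 𝕜 (AltWord J →₀ 𝕜))
    (hπ : ∀ τ, ∀ a ∈ D.alg τ, π a = D.act τ a)
    (hstar : ∀ τ k, star (D.basis τ k) = D.basis (!τ) k) {deg : J → ℕ}
    (hmul : ∀ τ i j, D.basis τ i * D.basis τ j ∈
      Submodule.span 𝕜 (insert 1 (D.basis τ '' {k | deg k ≤ deg i + deg j})))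
    (τ : Bool) (l : List J) {d n : ℕ} {m : AltWord J →₀ 𝕜} (hm : m ∈ bounded 𝕜 deg d n) :
    π (star (D.listVal τ l)) m ∈ bounded 𝕜 deg (d + (l.map deg).sum) (n + l.length) := by
  induction l generalizing τ d n m with
  | nil => simpa [listVal] using hm
  | cons k l ih =>
    rw [listVal, star_mul, hstar, map_mul, Module.End.mul_apply, hπ _ _ (D.basis_mem _ k)]
    refine bounded_mono deg ?_ ?_ (ih (!τ) (D.act_basis_mem_bounded hmul _ k hm))
    · rw [List.map_cons, List.sum_cons, add_assoc]
    · rw [List.length_cons, add_assoc, add_comm 1]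

end SubalgebraPair

/-- The functional of `w` is the coefficient of `w* w` in the action on the empty word. The squared
length enters the rank because, when `u* v` does not merge, the weights may balance exactly; strict
convexity of the square then separates words of different lengths. -/
theorem exists_faithful_positive_of_subalgebraPair {𝕜 A J : Type*} [RCLike 𝕜] [Ring A] [StarRing A]
    [Algebra 𝕜 A] [StarModule 𝕜 A] (D : SubalgebraPair 𝕜 A J)
    (hstar : ∀ τ k, star (D.basis τ k) = D.basis (!τ) k)
    (hgen : Algebra.adjoin 𝕜 (⋃ τ, (D.alg τ : Set A)) = ⊤)
    (deg : J → ℕ) (hdeg : ∀ n, {k | deg k ≤ n}.Finite)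
    (hmul : ∀ τ i j, D.basis τ i * D.basis τ j ∈
      Submodule.span 𝕜 (insert 1 (D.basis τ '' {k | deg k ≤ deg i + deg j})))
    (π : A →ₐ[𝕜] Module.End 𝕜 (AltWord J →₀ 𝕜)) (hπ : ∀ τ, ∀ a ∈ D.alg τ, π a = D.act τ a) :
    ∃ L : A →ₗ[𝕜] 𝕜, L.IsHermitianFunctional ∧ L.IsPositiveFunctional ∧
      ∀ a, L (star a * a) = 0 → a = 0 := by
  open AltWord in
  have hsame : ∀ τ (l l' : List J), π (star (D.listVal τ l) * D.listVal τ l')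
      (Finsupp.single none 1) = Finsupp.single (ofList (endCopy τ l) (l.reverse ++ l')) 1 := by
    intro τ l l'
    rw [map_mul, Module.End.mul_apply, D.rep_listVal π hπ, D.rep_star_listVal π hπ hstar]
  refine exists_faithful_positive_of_rank
    (fun w : AltWord J => w.weight deg + w.len ^ 2)
    (AltWord.finite_setOf_weight_add_sq_len_le deg hdeg) D.val
    (fun w => Finsupp.lapply w.starMulSelf ∘ₗ LinearMap.applyₗ (Finsupp.single none 1) ∘ₗ
      π.toLinearMap) ?_ (fun w => ?_) (fun u v w h => ?_)
  · rw [eq_top_iff]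
    intro a _
    have h := D.linearCombination_val_rep π hπ hgen a (Finsupp.single none 1)
    rw [Finsupp.linearCombination_single, one_smul, SubalgebraPair.val, mul_one] at h
    rw [← h, ← Finsupp.range_linearCombination]
    exact LinearMap.mem_range_self _ _
  · obtain ⟨τ, l, rfl⟩ := w.exists_eq_ofList
    simp [D.val_ofList, D.rep_listVal π hπ, D.rep_star_listVal π hπ hstar,
      AltWord.starMulSelf_ofList]
  · obtain ⟨τ, l, rfl⟩ := u.exists_eq_ofList
    obtain ⟨τ', l', rfl⟩ := v.exists_eq_ofList
    obtain ⟨σ, m, rfl⟩ := w.exists_eq_ofList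
    simp only [LinearMap.comp_apply, AlgHom.toLinearMap_apply, LinearMap.applyₗ_apply_apply,
      Finsupp.lapply_apply, D.val_ofList, AltWord.starMulSelf_ofList] at h
    simp only [AltWord.weight_ofList, AltWord.len_ofList]
    -- The empty word counts as starting in either copy. With a common starting copy `ρ`, the
    -- product `u* v` is a single alternating word.
    by_cases hτ : ∃ ρ, AltWord.ofList τ l = AltWord.ofList ρ l ∧
        AltWord.ofList τ' l' = AltWord.ofList ρ l'
    · obtain ⟨ρ, hl, hl'⟩ := hτ
      rw [hl, hl']
      rw [← D.val_ofList, ← D.val_ofList, hl, hl', D.val_ofList, D.val_ofList, hsame,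
        Finsupp.single_apply_ne_zero] at h
      obtain ⟨heq, hcopy⟩ := AltWord.ofList_eq_ofList h.1
      have hlen := congrArg List.length heq
      have hsum := congrArg (fun l => (List.map deg l).sum) heq
      simp only [List.length_append, List.length_reverse, List.map_append, List.map_reverse,
        List.sum_append, List.sum_reverse] at hlen hsum
      by_cases hll : l.length = l'.length
      · left
        obtain ⟨h1, rfl⟩ := List.append_inj heq (by simp; omega)
        obtain rfl := List.reverse_injective h1
        suffices AltWord.ofList ρ m = AltWord.ofList σ m from ⟨this, this⟩
        by_cases hm : m = []
        · rw [hm, AltWord.ofList_nil_eq]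
        · rw [AltWord.endCopy_injective m (hcopy (by simp [hm])).symm]
      · right
        by_contra hlt
        rw [not_lt, max_le_iff] at hlt
        -- Here `u* v = w* w` as words, so weight and length of `w` are the means of those of `u`
        -- and `v`; unequal lengths make the mean of the squares strictly larger than the square of
        -- the mean.
        have h1 : (l.length : ℤ) + l'.length = 2 * m.length := by omega
        have h2 : (l.length : ℤ) - l'.length ≠ 0 := by omega
        have h3 := sq_pos_of_ne_zero h2
        zify at hlt
        zify at hsum
        nlinarith [hlt.1, hlt.2]
    · right
      have hne : l ≠ [] ∧ l' ≠ [] ∧ τ' = !τ := by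
        refine ⟨?_, ?_, ?_⟩
        · rintro rfl
          exact hτ ⟨τ', rfl, rfl⟩
        · rintro rfl
          exact hτ ⟨τ, rfl, rfl⟩
        · rw [Bool.eq_not_iff]
          rintro rfl
          exact hτ ⟨_, rfl, rfl⟩
      obtain ⟨hl, hl', rfl⟩ := hne
      obtain ⟨k, l, rfl⟩ := List.exists_cons_of_ne_nil hl
      obtain ⟨k', l', rfl⟩ := List.exists_cons_of_ne_nil hl'
      -- The starred first letter of `u` and the first letter of `v` lie in the same copy and merge.
      -- The weight does not grow and at least one letter is lost, so `2 |w| ≤ |u| + |v| - 1`, which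
      -- again forces the rank of `w` below the maximum.
      have hmem : π (star (D.listVal τ (k :: l)) * D.listVal (!τ) (k' :: l'))
          (Finsupp.single none 1) ∈ SubalgebraPair.bounded 𝕜 deg
            (((k' :: l').map deg).sum + deg k + (l.map deg).sum) (l'.length + 1 + l.length) := by
        rw [map_mul, Module.End.mul_apply, D.rep_listVal π hπ, SubalgebraPair.listVal, star_mul,
          hstar, map_mul, Module.End.mul_apply, hπ _ _ (D.basis_mem _ k),
          D.act_single_ofList_cons]
        refine D.rep_star_listVal_mem_bounded π hπ hstar hmul _ _ ?_
        refine D.consMap_mem_bounded (hmul _ k k') ?_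
        simp only [List.map_cons, List.sum_cons]
        omega
      have hb := (Finsupp.mem_supported _ _).1 hmem (Finsupp.mem_support_iff.2 h)
      simp only [Set.mem_ofPred_eq, AltWord.weight_ofList, AltWord.len_ofList, List.map_append,
        List.map_reverse, List.sum_append, List.sum_reverse, List.length_append,
        List.length_reverse] at hb
      simp only [List.map_cons, List.sum_cons, List.length_cons] at hb ⊢
      obtain ⟨hd, hn⟩ := hb
      by_contra hlt
      rw [not_lt, max_le_iff] at hlt
      zify at hlt hd hn
      nlinarith [hlt.1, hlt.2, sq_nonneg ((l.length : ℤ) - l'.length)]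
-- Adapted bases of a finitely generated subalgebra and its star
section StarSpan

universe w

variable {𝕜 A : Type*} [RCLike 𝕜] [Ring A] [StarRing A] [Algebra 𝕜 A] [StarModule 𝕜 A]

theorem star_mem_span_image_star {S : Set A} {x : A} (hx : x ∈ Submodule.span 𝕜 S) :
    star x ∈ Submodule.span 𝕜 (star '' S) := by
  induction hx using Submodule.span_induction with
  | zero => simp
  | mem x hx => exact Submodule.subset_span ⟨x, hx, rfl⟩
  | add x y _ _ hx hy => rw [star_add]; exact add_mem hx hy
  | smul c x _ hx => rw [star_smul]; exact Submodule.smul_mem _ _ hx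

theorem LinearIndependent.star_comp {ι : Type*} {v : ι → A} (hv : LinearIndependent 𝕜 v) :
    LinearIndependent 𝕜 (fun i => star (v i)) := by
  rw [linearIndependent_iff'] at hv ⊢
  intro s c h i hi
  have h' := congrArg star h
  simp only [star_sum, star_smul, star_star, star_zero] at h'
  exact star_eq_zero.1 (hv s (fun i => star (c i)) h' i hi)

/-- A left inverse of the combination map extends the coordinates to all of `A`, with no control
outside the span. -/
theorem LinearIndependent.exists_coord {𝕜 A ι : Type*} [Field 𝕜] [AddCommGroup A] [Module 𝕜 A]
    {v : ι → A} (hv : LinearIndependent 𝕜 v) :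
    ∃ f : A →ₗ[𝕜] (ι →₀ 𝕜), ∀ i, f (v i) = Finsupp.single i 1 := by
  obtain ⟨f, hf⟩ := LinearMap.exists_leftInverse_of_injective (Finsupp.linearCombination 𝕜 v)
    (LinearMap.ker_eq_bot.2 hv)
  refine ⟨f, fun i => ?_⟩
  simpa using LinearMap.congr_fun hf (Finsupp.single i 1)

/-- A finitely generated subalgebra and its star have bases as in `SubalgebraPair` which are
interchanged by the star and compatible with a degree function. -/
theorem exists_subalgebraPair {A : Type w} [Ring A] [StarRing A] [Algebra 𝕜 A] [StarModule 𝕜 A]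
    [Nontrivial A] {S : Set A} (hS : S.Finite) :
    ∃ (J : Type w) (D : SubalgebraPair 𝕜 A J) (deg : J → ℕ),
      D.alg false = Algebra.adjoin 𝕜 S ∧ D.alg true = star (Algebra.adjoin 𝕜 S) ∧
      (∀ τ k, star (D.basis τ k) = D.basis (!τ) k) ∧ (∀ n, {k | deg k ≤ n}.Finite) ∧
      ∀ τ i j, D.basis τ i * D.basis τ j ∈
        Submodule.span 𝕜 (insert 1 (D.basis τ '' {k | deg k ≤ deg i + deg j})) := by
  set B := Algebra.adjoin 𝕜 S
  -- The filtration is by powers of `V`: `V ^ 0` is the line through `1`, and `V ^ m * V ^ n = V ^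
  -- (m + n)` makes the degree subadditive under products.
  set V : Submodule 𝕜 A := Submodule.span 𝕜 (insert 1 S) with hV
  have h1V : (1 : Submodule 𝕜 A) ≤ V := by
    rw [Submodule.one_eq_span]
    exact Submodule.span_mono (by simp)
  have hmono : Monotone fun n => V ^ n := monotone_nat_of_le_succ fun n => by
    rw [pow_succ]
    calc V ^ n = V ^ n * 1 := (mul_one _).symm
      _ ≤ V ^ n * V := mul_le_mul' le_rfl h1V
  have hVB : ∀ n, V ^ n ≤ Subalgebra.toSubmodule B := by
    intro n
    induction n with
    | zero =>
      rw [pow_zero, Submodule.one_eq_span, Submodule.span_le, Set.singleton_subset_iff]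
      exact one_mem B
    | succ n ih =>
      rw [pow_succ, Submodule.mul_le]
      have hVB1 : V ≤ Subalgebra.toSubmodule B := by
        rw [hV, Submodule.span_le]
        rintro _ (rfl | hx)
        · exact one_mem B
        · exact Algebra.subset_adjoin hx
      exact fun x hx y hy => mul_mem (S := Subalgebra 𝕜 A) (ih hx) (hVB1 hy)
  have hBV : ∀ a ∈ B, ∃ n, a ∈ V ^ n := by
    intro a ha
    induction ha using Algebra.adjoin_induction with
    | mem x hx => exact ⟨1, by rw [pow_one]; exact Submodule.subset_span (Or.inr hx)⟩
    | algebraMap r => exact ⟨0, by rw [pow_zero]; exact Submodule.algebraMap_mem r⟩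
    | add x y _ _ hx hy =>
      obtain ⟨m, hm⟩ := hx
      obtain ⟨n, hn⟩ := hy
      exact ⟨max m n, add_mem (hmono (le_max_left m n) hm) (hmono (le_max_right m n) hn)⟩
    | mul x y _ _ hx hy =>
      obtain ⟨m, hm⟩ := hx
      obtain ⟨n, hn⟩ := hy
      exact ⟨m + n, by rw [pow_add]; exact Submodule.mul_mem_mul hm hn⟩
  have hfg : ∀ n, (V ^ n).FG := fun n => (Submodule.fg_span (hS.insert 1)).pow n
  obtain ⟨J, b, deg, hli, hmem, hspan, hfin⟩ := exists_adapted_family (1 : A) one_ne_zero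
    (fun n => V ^ n) hmono hfg (by simp only [pow_zero, Submodule.one_eq_span])
  have hli' : LinearIndependent 𝕜 fun o : Option J => o.elim (1 : A) fun k => star (b k) := by
    convert hli.star_comp using 1
    ext (_ | k) <;> simp
  obtain ⟨f, hf⟩ := hli.exists_coord
  obtain ⟨f', hf'⟩ := hli'.exists_coord
  have hmemB : ∀ k, b k ∈ B := fun k => hVB _ (hmem k)
  have hspanB : ∀ a ∈ B, a ∈ Submodule.span 𝕜 (insert 1 (Set.range b)) := by
    intro a ha
    obtain ⟨n, hn⟩ := hBV a ha
    exact Submodule.span_mono (Set.insert_subset_insert (Set.image_subset_range _ _)) (hspan n hn)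
  have hmul : ∀ i j, b i * b j ∈ Submodule.span 𝕜 (insert 1 (b '' {k | deg k ≤ deg i + deg j})) :=
    fun i j => hspan _ (by
      simp only [pow_add]
      exact Submodule.mul_mem_mul (hmem i) (hmem j))
  let D : SubalgebraPair 𝕜 A J :=
    { basis := fun τ k => cond τ (star (b k)) (b k)
      alg := fun τ => cond τ (star B) B
      coord := fun τ => cond τ f' f
      basis_mem := by
        rintro (_ | _) k
        · exact hmemB k
        · exact Subalgebra.mem_star_iff _ _ |>.2 (by simpa using hmemB k)
      le_span := by
        rintro (_ | _) a ha
        · exact hspanB a ha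
        · have := star_mem_span_image_star (hspanB _ ((Subalgebra.mem_star_iff _ _).1 ha))
          rw [star_star, Set.image_insert_eq, star_one, ← Set.range_comp] at this
          exact this
      coord_one := by
        rintro (_ | _)
        · exact hf none
        · exact hf' none
      coord_basis := by
        rintro (_ | _) k
        · exact hf (some k)
        · exact hf' (some k) }
  refine ⟨J, D, deg, rfl, rfl, ?_, hfin, ?_⟩
  · rintro (_ | _) k
    · rfl
    · exact star_star _
  · rintro (_ | _) i j
    · exact hmul i j
    -- The star reverses products, so the indices are exchanged.
    · have := star_mem_span_image_star (hmul j i)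
      rw [star_mul, Set.image_insert_eq, star_one, Set.image_image, add_comm] at this
      exact this

end StarSpan

/-! ### The GNS representation -/

section GNS

/-- The GNS construction for a faithful positive functional: left multiplication is a faithful
star-representation. -/
theorem isOStarRepresentable_of_faithful_positive {𝕜 : Type*} {A : Type u} [RCLike 𝕜] [Ring A]
    [StarRing A] [Algebra 𝕜 A] [StarModule 𝕜 A] (L : A →ₗ[𝕜] 𝕜) (hherm : L.IsHermitianFunctional)
    (hpos : L.IsPositiveFunctional) (hfaith : ∀ a, L (star a * a) = 0 → a = 0) :
    IsOStarRepresentable 𝕜 A := by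
  let core : InnerProductSpace.Core 𝕜 A :=
    { inner := fun a b => L (star a * b)
      conj_inner_symm := fun a b => by
        change star (L (star b * a)) = L (star a * b)
        rw [← hherm, star_mul, star_star]
      re_inner_nonneg := fun a => (RCLike.nonneg_iff.1 (hpos a)).1
      add_left := fun a b c => by
        change L (star (a + b) * c) = L (star a * c) + L (star b * c)
        rw [star_add, add_mul, map_add]
      smul_left := fun a b r => by
        change L (star (r • a) * b) = star r * L (star a * b)
        rw [star_smul, smul_mul_assoc, map_smul, smul_eq_mul]
      -- Faithfulness makes the form definite, so `A` itself is the pre-Hilbert space and no null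
      -- space is divided out.
      definite := hfaith }
  let n : NormedAddCommGroup A := core.toNormedAddCommGroup
  let ip : InnerProductSpace 𝕜 A := InnerProductSpace.ofCore core.toCore
  have hinner : ∀ a b : A, inner 𝕜 a b = L (star a * b) := fun _ _ => rfl
  have hadj : ∀ a v w : A, inner 𝕜 (a * v) w = inner 𝕜 v (star a * w) := by
    intro a v w
    rw [hinner, hinner, star_mul, mul_assoc]
  let ρ : A →ₐ[𝕜] adjointableOperators 𝕜 A :=
    (Algebra.lmul 𝕜 A).codRestrict (adjointableOperators 𝕜 A) fun a =>
      ⟨Algebra.lmul 𝕜 A (star a), hadj a⟩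
  have hρ : ∀ a v : A, (ρ a).1 v = a * v := fun _ _ => rfl
  refine ⟨A, n, ip, { ρ with map_star' := fun a => ?_ }, fun a b h => ?_⟩
  · refine adjointableOperators.ext_inner fun v w => ?_
    rw [adjointableOperators.inner_star_right]
    change inner 𝕜 v ((ρ (star a)).1 w) = inner 𝕜 ((ρ a).1 v) w
    rw [hρ, hρ, hadj]
  · have h' : ρ a = ρ b := h
    have h1 := hρ a 1
    rw [h', hρ, mul_one, mul_one] at h1
    exact h1.symm

end GNS

/-! ### The quotient by analytic relations -/

namespace FreeStarAlgebra

variable {𝕜 : Type*} [RCLike 𝕜] {g : ℕ}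

theorem star_X (j : Fin g) : star (X j : FreeStarAlgebra 𝕜 g) =
    MonoidAlgebra.single (FreeMonoid.of (StarLetter.xStar j)) 1 := by
  rw [X, star_single, star_one]
  rfl

/-- The free star-algebra is generated by the variables and their stars. -/
theorem adjoin_X_union_star_X : Algebra.adjoin 𝕜
    (Set.range (X : Fin g → FreeStarAlgebra 𝕜 g) ∪ Set.range fun j => star (X j)) = ⊤ := by
  rw [eq_top_iff]
  rintro a -
  induction a using MonoidAlgebra.induction_on with
  | of w =>
    induction w using FreeMonoid.inductionOn' with
    | one => rw [map_one]; exact one_mem _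
    | of_mul l w ih =>
      rw [map_mul]
      refine mul_mem (Algebra.subset_adjoin ?_) ih
      cases l with
      | x j => exact Or.inl ⟨j, rfl⟩
      | xStar j => exact Or.inr ⟨j, star_X j⟩
  | add a b ha hb => exact add_mem ha hb
  | smul r a ha => exact Subalgebra.smul_mem _ ha r

/-- The quotient of the free star-algebra by a star-ideal generated by analytic polynomials has a
faithful positive functional. -/
theorem exists_faithful_positive_quotient (I : Ideal (FreeStarAlgebra 𝕜 g)) [I.IsStarIdeal]
    {P : Set (FreeStarAlgebra 𝕜 g)}
    (hP : P ⊆ (analyticPolynomials 𝕜 g : Set (FreeStarAlgebra 𝕜 g))) (hI : I = starIdealSpan P) :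
    ∃ L : (FreeStarAlgebra 𝕜 g ⧸ I) →ₗ[𝕜] 𝕜, L.IsHermitianFunctional ∧ L.IsPositiveFunctional ∧
      ∀ a, L (star a * a) = 0 → a = 0 := by
  -- A basis containing `1` requires `1 ≠ 0` in the quotient.
  rcases subsingleton_or_nontrivial (FreeStarAlgebra 𝕜 g ⧸ I) with hs | hn
  · exact ⟨0, fun _ => by simp, fun _ => by simp, fun _ _ => Subsingleton.elim _ _⟩
  set q : FreeStarAlgebra 𝕜 g →ₐ[𝕜] FreeStarAlgebra 𝕜 g ⧸ I := Ideal.Quotient.mkₐ 𝕜 I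
  have hqstar : ∀ a, star (q a) = q (star a) := fun a => Ideal.Quotient.star_mk I a
  have hqsurj : Function.Surjective q := Ideal.Quotient.mkₐ_surjective 𝕜 I
  obtain ⟨J, D, deg, hfalse, htrue, hstar, hdeg, hmul⟩ :=
    exists_subalgebraPair (𝕜 := 𝕜) (Set.finite_range fun j => q (X j))
  have halg : D.alg false = (analyticPolynomials 𝕜 g).map q := by
    rw [hfalse, analyticPolynomials, AlgHom.map_adjoin, ← Set.range_comp]
    rfl
  have hmemf : ∀ p ∈ analyticPolynomials 𝕜 g, q p ∈ D.alg false := fun p hp => by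
    rw [halg]; exact ⟨p, hp, rfl⟩
  have hmemt : ∀ a, a ∈ D.alg true ↔ star a ∈ D.alg false := fun a => by
    rw [htrue, hfalse, Subalgebra.mem_star_iff]
  have hmemt' : ∀ p ∈ analyticPolynomials 𝕜 g, q (star p) ∈ D.alg true := fun p hp => by
    rw [hmemt, hqstar, star_star]; exact hmemf p hp
  -- By freeness the action may be prescribed on the letters: `x_j` acts through the copy `false`,
  -- `x_j*` through the copy `true`.
  let Φ : FreeStarAlgebra 𝕜 g →ₐ[𝕜] Module.End 𝕜 (AltWord J →₀ 𝕜) :=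
    MonoidAlgebra.lift 𝕜 _ _ (FreeMonoid.lift fun l => match l with
      | StarLetter.x j => D.act false (q (X j))
      | StarLetter.xStar j => D.act true (q (star (X j))))
  have hΦX : ∀ j, Φ (X j) = D.act false (q (X j)) := fun j => by
    simp [Φ, X]
  have hΦX' : ∀ j, Φ (star (X j)) = D.act true (q (star (X j))) := fun j => by
    rw [star_X]
    simp only [Φ, MonoidAlgebra.lift_single, FreeMonoid.lift_eval_of, one_smul]
    rw [star_X]
  have hΦ : ∀ p ∈ analyticPolynomials 𝕜 g, Φ p = D.act false (q p) := by
    intro p hp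
    induction hp using Algebra.adjoin_induction with
    | mem x hx =>
      obtain ⟨j, rfl⟩ := hx
      exact hΦX j
    | algebraMap r =>
      simp only [Algebra.algebraMap_eq_smul_one, map_smul, map_one, D.act_one]
    | add x y _ _ hx hy => simp only [map_add, hx, hy]
    | mul x y _ hy' hx hy => rw [map_mul, map_mul, hx, hy, D.act_mul _ _ (hmemf y hy')]
  have hΦ' : ∀ p ∈ analyticPolynomials 𝕜 g, Φ (star p) = D.act true (q (star p)) := by
    intro p hp
    induction hp using Algebra.adjoin_induction with
    | mem x hx =>
      obtain ⟨j, rfl⟩ := hx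
      exact hΦX' j
    | algebraMap r =>
      simp only [Algebra.algebraMap_eq_smul_one, star_smul, star_one, map_smul, map_one, D.act_one]
    | add x y _ _ hx hy => simp only [star_add, map_add, hx, hy]
    | mul x y hx' _ hx hy =>
      rw [star_mul, map_mul, map_mul, hx, hy, D.act_mul _ _ (hmemt' x hx')]
  -- No star is available on the endomorphisms, so the vanishing of `Φ (star a)` is imposed to
  -- obtain a star-ideal.
  let K : Ideal (FreeStarAlgebra 𝕜 g) :=
    { carrier := {a | Φ a = 0 ∧ Φ (star a) = 0}
      add_mem' := fun ha hb => by
        simp [ha.1, ha.2, hb.1, hb.2]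
      zero_mem' := by simp
      smul_mem' := fun c a ha => by
        simp [ha.1, ha.2] }
  have hK : K.IsStarIdeal := ⟨fun a ha => ⟨ha.2, by rw [star_star]; exact ha.1⟩⟩
  -- Analyticity is decisive here: on `p` and `star p`, for `p` in `P`, the map `Φ` is the action of
  -- a single copy through `q`, and `q` kills both.
  have hIK : I ≤ K := by
    have hq0 : ∀ p ∈ I, q p = 0 := fun p hp => Ideal.Quotient.eq_zero_iff_mem.2 hp
    have hPI : ∀ p ∈ P, p ∈ I := fun p hp => by rw [hI]; exact subset_starIdealSpan P hp
    refine hI.le.trans (starIdealSpan_le hK fun p hp => ⟨?_, ?_⟩)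
    · rw [hΦ p (hP hp), hq0 p (hPI p hp), map_zero]
    · rw [hΦ' p (hP hp), hq0 _ (Ideal.star_mem_of_isStarIdeal (hPI p hp)), map_zero]
  let π : (FreeStarAlgebra 𝕜 g ⧸ I) →ₐ[𝕜] Module.End 𝕜 (AltWord J →₀ 𝕜) :=
    Ideal.Quotient.liftₐ I Φ fun a ha => (hIK ha).1
  have hπq : ∀ a, π (q a) = Φ a := fun a => rfl
  refine exists_faithful_positive_of_subalgebraPair D hstar ?_ deg hdeg hmul π ?_
  · rw [eq_top_iff, ← (AlgHom.range_eq_top q).2 hqsurj, ← Algebra.map_top,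
      ← adjoin_X_union_star_X, AlgHom.map_adjoin]
    refine Algebra.adjoin_mono ?_
    rintro _ ⟨_, ⟨j, rfl⟩ | ⟨j, rfl⟩, rfl⟩
    · exact Set.mem_iUnion.2 ⟨false, hmemf _ (Algebra.subset_adjoin ⟨j, rfl⟩)⟩
    · exact Set.mem_iUnion.2 ⟨true, hmemt' _ (Algebra.subset_adjoin ⟨j, rfl⟩)⟩
  · rintro (_ | _) a ha
    · rw [halg] at ha
      obtain ⟨p, hp, rfl⟩ := ha
      exact hΦ p hp
    · rw [hmemt, halg] at ha
      obtain ⟨p, hp, hpa⟩ := ha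
      obtain rfl : q (star p) = a := by
        rw [← hqstar, ← star_star a]
        exact congrArg star hpa
      exact hΦ' p hp

end FreeStarAlgebra

/-- Let `𝕜` be `ℝ` or `ℂ` and let `I` be a star-ideal of the free star-algebra generated by
analytic polynomials. Then there is a positive hermitian linear functional `L` with
`I = {a | L(a* a) = 0}`, and the quotient star-algebra is O*-representable. -/
theorem proposition4p3 {𝕜 : Type*} [RCLike 𝕜] (g : ℕ)
    (I : Ideal (FreeStarAlgebra 𝕜 g)) [I.IsStarIdeal]
    (hI : ∃ P : Set (FreeStarAlgebra 𝕜 g),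
      P ⊆ (FreeStarAlgebra.analyticPolynomials 𝕜 g : Set (FreeStarAlgebra 𝕜 g)) ∧
        I = starIdealSpan P) :
    (∃ L : FreeStarAlgebra 𝕜 g →ₗ[𝕜] 𝕜,
      L.IsHermitianFunctional ∧ L.IsPositiveFunctional ∧
        (I : Set (FreeStarAlgebra 𝕜 g)) = {a | L (star a * a) = 0}) ∧
      IsOStarRepresentable 𝕜 (FreeStarAlgebra 𝕜 g ⧸ I) := by

  obtain ⟨P, hP, hIP⟩ := hI
  obtain ⟨L, hherm, hpos, hfaith⟩ := FreeStarAlgebra.exists_faithful_positive_quotient I hP hIP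
  refine ⟨⟨L ∘ₗ (Ideal.Quotient.mkₐ 𝕜 I).toLinearMap, fun a => hherm (Ideal.Quotient.mk I a),
    fun a => ?_, ?_⟩, isOStarRepresentable_of_faithful_positive L hherm hpos hfaith⟩
  · have h := hpos (Ideal.Quotient.mk I a)
    rwa [Ideal.Quotient.star_mk, ← map_mul] at h
  · ext a
    have h : (L ∘ₗ (Ideal.Quotient.mkₐ 𝕜 I).toLinearMap) (star a * a) =
        L (star (Ideal.Quotient.mk I a) * Ideal.Quotient.mk I a) := by
      rw [Ideal.Quotient.star_mk, ← map_mul]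
      rfl
    rw [Set.mem_ofPred_eq, h, SetLike.mem_coe, ← Ideal.Quotient.eq_zero_iff_mem]
    exact ⟨fun h0 => by rw [h0, mul_zero, map_zero], hfaith _⟩
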